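/- **Theorem 3.1.** Let $n \ge 0$ and let $\mathbb{C}\mathfrak{S}_n$ be the complex vector space with basis the symmetric group $\mathfrak{S}_n$; a permutation $\mu$ is written as the word $\mu_1\cdots\mu_n$ with $\mu_i=\mu(i)$. Operators act on the right, so $fg$ means: first $f$, then $g$. For $\sigma\in\mathfrak{S}_n$ let $\sigma$ also denote the operator $\mu\mapsto\mu\sigma$. For $1\le i\le n-1$ let $\sigma_i$ be the transposition exchanging $i$ and $i+1$, and let $\pi_i$ be the operator with $$\mu\cdot\pi_i=\begin{cases}\mu & \text{if } \mu_i>\mu_{i+1},\\ \mu\sigma_i & \text{otherwise.}\end{cases}$$ For $\tau\in\mathfrak{S}_n$ let $\pi_\tau=\pi_{i_1}\cdots\pi_{i_p}$, where $\tau=\sigma_{i_1}\cdots\sigma_{i_p}$ is a reduced word (a word of minimal length); this operator does not depend on the choice of the reduced word. Let $\mathrm{H}\mathfrak{S}_n$ be the unital subalgebra of $\mathrm{End}(\mathbb{C}\mathfrak{S}_n)$ generated by $\sigma_1,\dots,\sigma_{n-1},\pi_1,\dots,\pi_{n-1}$, and let $\mathrm{Des}(\mu)=\{i : \mu_i>\mu_{i+1}\}$.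 Then the family of operators $\sigma\pi_\tau$, indexed by the pairs $(\sigma,\tau)\in\mathfrak{S}_n\times\mathfrak{S}_n$ with $\mathrm{Des}(\sigma)\cap\mathrm{Des}(\tau^{-1})=\emptyset$, is a vector space basis of $\mathrm{H}\mathfrak{S}_n$. Hence $\dim \mathrm{H}\mathfrak{S}_n = h_n$, the number of pairs $(\sigma,\tau)\in\mathfrak{S}_n\times\mathfrak{S}_n$ with $\mathrm{Des}(\sigma)\cap\mathrm{Des}(\tau)=\emptyset$. -/

import Mathlib

namespace HeckeSymm

open Equiv

variable {n : ℕ}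

/-- The position `i` in `Fin n`. The `n - 1` pairs of adjacent positions are indexed by
`Fin (n - 1)`, counting from `0`. -/
def lo (i : Fin (n - 1)) : Fin n := ⟨i.1, by have := i.2; omega⟩

/-- The position `i + 1` in `Fin n`. -/
def hi (i : Fin (n - 1)) : Fin n := ⟨i.1 + 1, by have := i.2; omega⟩

/-- The elementary transposition exchanging `i` and `i + 1`. -/
def s (i : Fin (n - 1)) : Perm (Fin n) := swap (lo i) (hi i)

/-- The descent set `{i | μ (i) > μ (i + 1)}` of a permutation. -/
def Des (μ : Perm (Fin n)) : Finset (Fin (n - 1)) :=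
  Finset.univ.filter fun i => μ (hi i) < μ (lo i)

/-- The vector space with basis the permutations of `n` letters. -/
abbrev V (n : ℕ) : Type := Perm (Fin n) →₀ ℂ

/-- Product of operators acting on the right: `f` acts first, then `g`. -/
noncomputable def rmul (f g : Module.End ℂ (V n)) : Module.End ℂ (V n) := g ∘ₗ f

/-- The operator `μ ↦ μ σ` of right multiplication by a permutation (action on positions). -/
noncomputable def sigmaOp (σ : Perm (Fin n)) : Module.End ℂ (V n) :=
  Finsupp.lmapDomain ℂ ℂ fun μ => μ * σ

/-- Decreasing sort of the letters in positions `i` and `i + 1`. -/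
def sortStep (i : Fin (n - 1)) (μ : Perm (Fin n)) : Perm (Fin n) :=
  if μ (hi i) < μ (lo i) then μ else μ * s i

/-- The elementary decreasing sorting operator. -/
noncomputable def piOp (i : Fin (n - 1)) : Module.End ℂ (V n) :=
  Finsupp.lmapDomain ℂ ℂ (sortStep i)

/-- The unital subalgebra of all endomorphisms of `V n` generated by the elementary
transpositions, acting on positions, and the elementary decreasing sorting operators.
(Whether one composes from the left or from the right makes no difference to its elements.) -/
noncomputable def HS (n : ℕ) : Subalgebra ℂ (Module.End ℂ (V n)) :=
  Algebra.adjoin ℂ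
    (Set.range (fun i : Fin (n - 1) => sigmaOp (s i)) ∪ Set.range (piOp (n := n)))

/-- The permutation spelled by a word in the elementary transpositions. -/
def wordProd (w : List (Fin (n - 1))) : Perm (Fin n) := (w.map s).prod

/-- `w` is a word of minimal length among the words that spell `τ`. -/
def IsReducedWord (w : List (Fin (n - 1))) (τ : Perm (Fin n)) : Prop :=
  wordProd w = τ ∧ ∀ w' : List (Fin (n - 1)), wordProd w' = τ → w.length ≤ w'.length

/-- The product of the sorting operators along a word; the first letter acts first. -/
noncomputable def piWord : List (Fin (n - 1)) → Module.End ℂ (V n)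
  | [] => LinearMap.id
  | i :: w => rmul (piOp i) (piWord w)

theorem exists_word (τ : Perm (Fin n)) : ∃ w : List (Fin (n - 1)), wordProd w = τ := by
  cases n with
  | zero => exact ⟨[], Subsingleton.elim _ _⟩
  | succ m =>
    have h : τ ∈ Submonoid.closure
        (Set.range fun i : Fin m => swap i.castSucc i.succ) := by
      rw [Equiv.Perm.mclosure_swap_castSucc_succ]; trivial
    induction h using Submonoid.closure_induction with
    | mem x hx =>
      obtain ⟨i, rfl⟩ := hx
      exact ⟨[i], by simp [wordProd, s]; rfl⟩
    | one => exact ⟨[], rfl⟩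
    | mul x y _ _ hx hy =>
      obtain ⟨u, rfl⟩ := hx
      obtain ⟨v, rfl⟩ := hy
      exact ⟨u ++ v, by simp [wordProd]⟩

theorem exists_reducedWord (τ : Perm (Fin n)) :
    ∃ w : List (Fin (n - 1)), IsReducedWord w τ := by
  obtain ⟨w, hw, hmin⟩ := WellFounded.has_min (measure (List.length (α := Fin (n - 1)))).wf
    {w | wordProd w = τ} (exists_word τ)
  exact ⟨w, hw, fun w' hw' => not_lt.mp (hmin w' hw')⟩

/-- The operator `π_τ`: the product of the sorting operators along a reduced word of `τ`. -/
noncomputable def piPerm (τ : Perm (Fin n)) : Module.End ℂ (V n) :=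
  piWord (exists_reducedWord τ).choose

/-- The pairs `(σ, τ)` such that `σ` and `τ⁻¹` have no common descent. -/
abbrev BIndex (n : ℕ) : Type :=
  {p : Perm (Fin n) × Perm (Fin n) // Des p.1 ∩ Des p.2⁻¹ = ∅}

/-- The family of operators `σ π_τ` (first `σ`, then `π_τ`). -/
noncomputable def B (n : ℕ) (p : BIndex n) : Module.End ℂ (V n) :=
  rmul (sigmaOp p.1.1) (piPerm p.1.2)

/-- The number of pairs of permutations with disjoint descent sets. -/
def h (n : ℕ) : ℕ :=
  (Finset.univ.filter fun p : Perm (Fin n) × Perm (Fin n) => Des p.1 ∩ Des p.2 = ∅).card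

end HeckeSymm

namespace HeckeSymm

open Equiv

variable {n : ℕ}

/-! ### Elementary transpositions and descents -/

/-! The dimension is squeezed between two counts, both equal to `h n`. Lower bound: sorting
positions commutes with sorting values (`sortLeft_sortStep`), so `x · π_τ` is also obtained from `τ`
by sorting values along a reduced word of `x⁻¹`. Inversions can then only increase, and `τ` stays
put only if every letter of that word is a descent of `τ⁻¹`, which puts `x` in the Young subgroup of
`Des τ⁻¹`. As `σ` is the minimal representative of its coset of that subgroup, the family is
triangular (`B_apply_eq_zero`), hence independent. Upper bound: the generators preserve the vectors
antisymmetric under exchanging the values `j` and `j + 1`. An operator with this property is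
determined by its coefficients at the pairs `(μ, ν)` with `Des μ⁻¹ ⊆ Des ν⁻¹`
(`eq_zero_of_mem_antisymmPreserving`), and reversing values shows that there are `h n` such pairs.
-/

theorem lo_lt_hi (i : Fin (n - 1)) : lo i < hi i := by
  simp [lo, hi, Fin.lt_def]

theorem mem_Des {μ : Perm (Fin n)} {i : Fin (n - 1)} : i ∈ Des μ ↔ μ (hi i) < μ (lo i) := by
  simp [Des]

theorem not_mem_Des {μ : Perm (Fin n)} {i : Fin (n - 1)} :
    i ∉ Des μ ↔ μ (lo i) < μ (hi i) := by
  rw [mem_Des, not_lt]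
  exact ⟨fun h => lt_of_le_of_ne h fun e => (lo_lt_hi i).ne (μ.injective e), le_of_lt⟩

theorem inv_apply_apply (μ : Perm (Fin n)) (a : Fin n) : μ⁻¹ (μ a) = a := μ.symm_apply_apply a

theorem apply_inv_apply (μ : Perm (Fin n)) (a : Fin n) : μ (μ⁻¹ a) = a := μ.apply_symm_apply a

@[simp] theorem s_mul_s (i : Fin (n - 1)) : s i * s i = 1 := swap_mul_self _ _

@[simp] theorem s_inv (i : Fin (n - 1)) : (s i)⁻¹ = s i := swap_inv _ _

@[simp] theorem s_lo (i : Fin (n - 1)) : s i (lo i) = hi i := swap_apply_left _ _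

@[simp] theorem s_hi (i : Fin (n - 1)) : s i (hi i) = lo i := swap_apply_right _ _

@[simp] theorem s_s (i : Fin (n - 1)) (a : Fin n) : s i (s i a) = a := swap_apply_self _ _ _

@[simp] theorem mul_s_mul_s (μ : Perm (Fin n)) (i : Fin (n - 1)) : μ * s i * s i = μ := by
  rw [mul_assoc, s_mul_s, mul_one]

@[simp] theorem s_mul_s_mul (μ : Perm (Fin n)) (i : Fin (n - 1)) : s i * (s i * μ) = μ := by
  rw [← mul_assoc, s_mul_s, one_mul]

theorem mem_Des_mul_s {μ : Perm (Fin n)} {i : Fin (n - 1)} : i ∈ Des (μ * s i) ↔ i ∉ Des μ := by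
  rw [not_mem_Des, mem_Des]; simp

theorem s_lt_s {j : Fin (n - 1)} {a b : Fin n} (h : a < b) (hab : ¬ (a = lo j ∧ b = hi j)) :
    s j a < s j b := by
  simp only [s, swap_apply_def]
  simp only [Fin.lt_def, Fin.ext_iff, lo, hi] at *
  split_ifs <;> simp <;> omega

theorem s_mul_eq_mul_s {μ : Perm (Fin n)} {i j : Fin (n - 1)}
    (h : (μ (lo i) = lo j ∧ μ (hi i) = hi j) ∨ (μ (lo i) = hi j ∧ μ (hi i) = lo j)) :
    s j * μ = μ * s i := by
  have : μ * s i = swap (μ (lo i)) (μ (hi i)) * μ := mul_swap_eq_swap_mul _ _ _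
  rw [this]
  rcases h with ⟨h1, h2⟩ | ⟨h1, h2⟩
  · rw [h1, h2]; rfl
  · rw [h1, h2, swap_comm]; rfl

theorem apply_of_s_mul_eq_mul_s {μ : Perm (Fin n)} {i j : Fin (n - 1)} (h : s j * μ = μ * s i) :
    (μ (lo i) = lo j ∧ μ (hi i) = hi j) ∨ (μ (lo i) = hi j ∧ μ (hi i) = lo j) := by
  have h1 : s j (μ (lo i)) = μ (hi i) := by
    have := congrArg (fun p => p (lo i)) h
    simpa using this
  have hne : μ (lo i) ≠ μ (hi i) := fun e => (lo_lt_hi i).ne (μ.injective e)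
  by_cases ha : μ (lo i) = lo j
  · left; rw [ha, s_lo] at h1; exact ⟨ha, h1.symm⟩
  by_cases hb : μ (lo i) = hi j
  · right; rw [hb, s_hi] at h1; exact ⟨hb, h1.symm⟩
  exact absurd ((swap_apply_of_ne_of_ne ha hb).symm.trans h1) hne

/-- Exchanging the values `j` and `j + 1` alters the relative order of these two values only, and
the hypothesis says that they do not occupy the positions `i` and `i + 1`. -/
theorem mem_Des_s_mul {μ : Perm (Fin n)} {i j : Fin (n - 1)} (h : s j * μ ≠ μ * s i) :
    i ∈ Des (s j * μ) ↔ i ∈ Des μ := by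
  by_cases hd : i ∈ Des μ
  · refine iff_of_true ?_ hd
    rw [mem_Des] at hd ⊢
    exact s_lt_s hd fun e => h (s_mul_eq_mul_s (Or.inr ⟨e.2, e.1⟩))
  · refine iff_of_false ?_ hd
    rw [not_mem_Des] at hd ⊢
    exact s_lt_s hd fun e => h (s_mul_eq_mul_s (Or.inl e))

theorem eq_one_of_Des_eq_empty {μ : Perm (Fin n)} (h : Des μ = ∅) : μ = 1 := by
  have hm : StrictMono μ := by
    cases n with
    | zero => exact fun a => a.elim0
    | succ m =>
      refine Fin.strictMono_iff_lt_succ.2 fun i => ?_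
      have : (i : Fin (m + 1 - 1)) ∉ Des μ := by rw [h]; simp
      exact not_mem_Des.1 this
  have : hm.orderIsoOfSurjective _ μ.surjective = OrderIso.refl _ := Subsingleton.elim _ _
  ext a
  exact congrArg (fun e : Fin n ≃o Fin n => (e a : ℕ)) this

/-! ### Inversions and reduced words -/

/-- The set of inversions of a permutation. -/
def inversions (μ : Perm (Fin n)) : Finset (Fin n × Fin n) :=
  Finset.univ.filter fun p => p.1 < p.2 ∧ μ p.2 < μ p.1

/-- The number of inversions of a permutation. -/
def inv (μ : Perm (Fin n)) : ℕ := (inversions μ).card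

theorem mem_inversions {μ : Perm (Fin n)} {p : Fin n × Fin n} :
    p ∈ inversions μ ↔ p.1 < p.2 ∧ μ p.2 < μ p.1 := by
  simp [inversions]

@[simp] theorem inv_one : inv (1 : Perm (Fin n)) = 0 := by
  rw [inv, Finset.card_eq_zero, Finset.eq_empty_iff_forall_notMem]
  intro p hp
  rw [mem_inversions] at hp
  exact lt_asymm hp.1 hp.2

theorem inv_inverse (μ : Perm (Fin n)) : inv μ⁻¹ = inv μ := by
  refine Finset.card_bij' (fun p _ => (μ⁻¹ p.2, μ⁻¹ p.1)) (fun p _ => (μ p.2, μ p.1)) ?_ ?_ ?_ ?_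
  · intro p hp; rw [mem_inversions] at hp ⊢; simpa [and_comm] using hp
  · intro p hp; rw [mem_inversions] at hp ⊢; simpa [and_comm] using hp
  · intro p _; simp
  · intro p _; simp

theorem inv_mul_s_of_notMem {μ : Perm (Fin n)} {i : Fin (n - 1)} (h : i ∉ Des μ) :
    inv (μ * s i) = inv μ + 1 := by
  have hmem : (lo i, hi i) ∈ inversions (μ * s i) := by
    rw [mem_inversions]
    exact ⟨lo_lt_hi i, mem_Des.1 (mem_Des_mul_s.2 h)⟩
  rw [inv, ← Finset.card_erase_add_one hmem, inv]
  congr 1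
  rw [not_mem_Des] at h
  -- `s i` moves the inversions of `μ * s i` other than the new pair `(lo i, hi i)` onto those of
  -- `μ`.
  refine Finset.card_bij' (fun p _ => (s i p.1, s i p.2)) (fun p _ => (s i p.1, s i p.2))
    ?_ ?_ ?_ ?_
  · rintro ⟨a, b⟩ hp
    rw [Finset.mem_erase, mem_inversions] at hp
    rw [mem_inversions]
    exact ⟨s_lt_s hp.2.1 fun e => hp.1 (Prod.ext e.1 e.2), hp.2.2⟩
  · rintro ⟨a, b⟩ hp
    rw [mem_inversions] at hp
    rw [Finset.mem_erase, mem_inversions]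
    have hne : ¬ (a = lo i ∧ b = hi i) := by
      rintro ⟨rfl, rfl⟩
      exact lt_asymm h hp.2
    refine ⟨fun e => ?_, s_lt_s hp.1 hne, by simpa using hp.2⟩
    rw [Prod.mk.injEq] at e
    have h1 : a = hi i := by rw [← s_s i a, e.1, s_lo]
    have h2 : b = lo i := by rw [← s_s i b, e.2, s_hi]
    have h3 : a < b := hp.1
    rw [h1, h2] at h3
    exact lt_asymm h3 (lo_lt_hi i)
  · intro p _; simp
  · intro p _; simp

theorem inv_mul_s_of_mem {μ : Perm (Fin n)} {i : Fin (n - 1)} (h : i ∈ Des μ) :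
    inv μ = inv (μ * s i) + 1 := by
  have := inv_mul_s_of_notMem (μ := μ * s i) (i := i) (by rwa [mem_Des_mul_s, not_not])
  rwa [mul_s_mul_s] at this

theorem wordProd_append_singleton (w : List (Fin (n - 1))) (i : Fin (n - 1)) :
    wordProd (w ++ [i]) = wordProd w * s i := by
  simp [wordProd]

theorem inv_wordProd_le (w : List (Fin (n - 1))) : inv (wordProd w) ≤ w.length := by
  induction w using List.reverseRecOn with
  | nil => simp [wordProd]
  | append_singleton w i ih =>
    rw [wordProd_append_singleton, List.length_append, List.length_singleton]
    by_cases h : i ∈ Des (wordProd w)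
    · have := inv_mul_s_of_mem h; omega
    · have := inv_mul_s_of_notMem h; omega

theorem exists_word_length_eq_inv (τ : Perm (Fin n)) :
    ∃ w : List (Fin (n - 1)), wordProd w = τ ∧ w.length = inv τ := by
  induction hk : inv τ generalizing τ with
  | zero =>
    refine ⟨[], ?_, rfl⟩
    refine (eq_one_of_Des_eq_empty (Finset.eq_empty_iff_forall_notMem.2 fun i hi => ?_)).symm
    have := inv_mul_s_of_mem hi
    omega
  | succ k ih =>
    have : (Des τ).Nonempty := by
      rw [Finset.nonempty_iff_ne_empty]
      intro h
      rw [eq_one_of_Des_eq_empty h, inv_one] at hk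
      omega
    obtain ⟨i, hi⟩ := this
    obtain ⟨w, hw, hl⟩ := ih (τ * s i) (by have := inv_mul_s_of_mem hi; omega)
    exact ⟨w ++ [i], by rw [wordProd_append_singleton, hw, mul_s_mul_s], by simp [hl]⟩

theorem IsReducedWord.length_eq {w : List (Fin (n - 1))} {τ : Perm (Fin n)}
    (h : IsReducedWord w τ) : w.length = inv τ := by
  obtain ⟨w', hw', hl⟩ := exists_word_length_eq_inv τ
  have h1 := h.2 w' hw'
  have h2 := inv_wordProd_le w
  rw [h.1] at h2
  omega

/-! ### Sorting along words, on positions and on values -/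

theorem sortStep_of_mem {i : Fin (n - 1)} {μ : Perm (Fin n)} (h : i ∈ Des μ) :
    sortStep i μ = μ := if_pos (mem_Des.1 h)

theorem sortStep_of_notMem {i : Fin (n - 1)} {μ : Perm (Fin n)} (h : i ∉ Des μ) :
    sortStep i μ = μ * s i := if_neg fun h' => h (mem_Des.2 h')

theorem sortStep_mul_s (i : Fin (n - 1)) (μ : Perm (Fin n)) :
    sortStep i (μ * s i) = sortStep i μ := by
  by_cases h : i ∈ Des μ
  · rw [sortStep_of_mem h, sortStep_of_notMem (by rwa [mem_Des_mul_s, not_not]), mul_s_mul_s]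
  · rw [sortStep_of_notMem h, sortStep_of_mem (mem_Des_mul_s.2 h)]

theorem sortStep_s_mul (i j : Fin (n - 1)) (μ : Perm (Fin n)) :
    sortStep i (s j * μ) = sortStep i μ ∨ sortStep i (s j * μ) = s j * sortStep i μ := by
  by_cases h : s j * μ = μ * s i
  · left; rw [h, sortStep_mul_s]
  · right
    by_cases hd : i ∈ Des μ
    · rw [sortStep_of_mem hd, sortStep_of_mem ((mem_Des_s_mul h).2 hd)]
    · rw [sortStep_of_notMem hd, sortStep_of_notMem (mt (mem_Des_s_mul h).1 hd), mul_assoc]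

/-- Decreasing sort of the positions of the letters `j` and `j + 1`. -/
def sortLeft (j : Fin (n - 1)) (μ : Perm (Fin n)) : Perm (Fin n) := (sortStep j μ⁻¹)⁻¹

theorem sortLeft_of_mem {j : Fin (n - 1)} {μ : Perm (Fin n)} (h : j ∈ Des μ⁻¹) :
    sortLeft j μ = μ := by
  rw [sortLeft, sortStep_of_mem h, inv_inv]

theorem sortLeft_of_notMem {j : Fin (n - 1)} {μ : Perm (Fin n)} (h : j ∉ Des μ⁻¹) :
    sortLeft j μ = s j * μ := by
  rw [sortLeft, sortStep_of_notMem h, mul_inv_rev, inv_inv, s_inv]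

theorem sortLeft_s_mul (j : Fin (n - 1)) (μ : Perm (Fin n)) :
    sortLeft j (s j * μ) = sortLeft j μ := by
  rw [sortLeft, mul_inv_rev, s_inv, sortStep_mul_s, sortLeft]

theorem mem_Des_inv_iff {i j : Fin (n - 1)} {μ : Perm (Fin n)} (h : s j * μ = μ * s i) :
    j ∈ Des μ⁻¹ ↔ i ∈ Des μ := by
  rw [mem_Des, mem_Des]
  rcases apply_of_s_mul_eq_mul_s h with ⟨h1, h2⟩ | ⟨h1, h2⟩
  · rw [h1, h2, ← h1, ← h2, inv_apply_apply, inv_apply_apply, h1, h2]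
    exact iff_of_false (lo_lt_hi i).not_gt (lo_lt_hi j).not_gt
  · rw [h1, h2, ← h1, ← h2, inv_apply_apply, inv_apply_apply, h1, h2]
    exact iff_of_true (lo_lt_hi i) (lo_lt_hi j)

/-- If the letters `j, j + 1` sit at the positions `i, i + 1`, both operations are the same sort;
otherwise neither affects the comparison made by the other. -/
theorem sortLeft_sortStep (i j : Fin (n - 1)) (μ : Perm (Fin n)) :
    sortLeft j (sortStep i μ) = sortStep i (sortLeft j μ) := by
  by_cases h : s j * μ = μ * s i
  · by_cases hd : i ∈ Des μ
    · have hd' := (mem_Des_inv_iff h).2 hd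
      rw [sortStep_of_mem hd, sortLeft_of_mem hd', sortStep_of_mem hd]
    · have hd' := mt (mem_Des_inv_iff h).1 hd
      rw [sortLeft_of_notMem hd', h, sortStep_mul_s, sortStep_of_notMem hd, ← h, sortLeft_s_mul,
        sortLeft_of_notMem hd']
  · have h' : s i * μ⁻¹ ≠ μ⁻¹ * s j := fun e => h <| by
      have := congrArg (·⁻¹) e
      simpa using this.symm
    have key := mem_Des_s_mul h
    have key' : j ∈ Des (μ * s i)⁻¹ ↔ j ∈ Des μ⁻¹ := by
      rw [mul_inv_rev, s_inv]; exact mem_Des_s_mul h'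
    by_cases hi : i ∈ Des μ <;> by_cases hj : j ∈ Des μ⁻¹
    · rw [sortStep_of_mem hi, sortLeft_of_mem hj, sortStep_of_mem hi]
    · rw [sortStep_of_mem hi, sortLeft_of_notMem hj, sortStep_of_mem (key.2 hi)]
    · rw [sortStep_of_notMem hi, sortLeft_of_mem hj, sortLeft_of_mem (key'.2 hj),
        sortStep_of_notMem hi]
    · rw [sortStep_of_notMem hi, sortLeft_of_notMem hj, sortLeft_of_notMem (mt key'.1 hj),
        sortStep_of_notMem (mt key.1 hi), mul_assoc]

/-- Successive sorting of positions along a word. -/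
def sortWord (w : List (Fin (n - 1))) (μ : Perm (Fin n)) : Perm (Fin n) :=
  w.foldl (fun ν i => sortStep i ν) μ

/-- Successive sorting of values along a word. -/
def sortLeftWord (u : List (Fin (n - 1))) (μ : Perm (Fin n)) : Perm (Fin n) :=
  u.foldl (fun ν j => sortLeft j ν) μ

theorem sortLeftWord_eq (u : List (Fin (n - 1))) (μ : Perm (Fin n)) :
    sortLeftWord u μ = (sortWord u μ⁻¹)⁻¹ := by
  induction u generalizing μ with
  | nil => simp [sortLeftWord, sortWord]
  | cons j u ih =>
    change sortLeftWord u (sortLeft j μ) = (sortWord u (sortStep j μ⁻¹))⁻¹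
    rw [ih, sortLeft, inv_inv]

theorem sortLeft_sortWord (w : List (Fin (n - 1))) (j : Fin (n - 1)) (μ : Perm (Fin n)) :
    sortLeft j (sortWord w μ) = sortWord w (sortLeft j μ) := by
  induction w generalizing μ with
  | nil => rfl
  | cons i w ih =>
    change sortLeft j (sortWord w (sortStep i μ)) = sortWord w (sortStep i (sortLeft j μ))
    rw [ih, sortLeft_sortStep]

theorem sortLeftWord_sortWord (u w : List (Fin (n - 1))) (μ : Perm (Fin n)) :
    sortLeftWord u (sortWord w μ) = sortWord w (sortLeftWord u μ) := by
  induction u generalizing μ with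
  | nil => rfl
  | cons j u ih =>
    change sortLeftWord u (sortLeft j (sortWord w μ)) = sortWord w (sortLeftWord u (sortLeft j μ))
    rw [sortLeft_sortWord, ih]

/-- The length condition passes to prefixes and makes every step an ascent, so each sort really
multiplies by its transposition. -/
theorem sortWord_one_of_length_eq (w : List (Fin (n - 1))) (h : w.length = inv (wordProd w)) :
    sortWord w 1 = wordProd w := by
  induction w using List.reverseRecOn with
  | nil => rfl
  | append_singleton w i ih =>
    have hle := inv_wordProd_le w
    rw [wordProd_append_singleton] at h ⊢
    rw [List.length_append, List.length_singleton] at h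
    by_cases hd : i ∈ Des (wordProd w)
    · have := inv_mul_s_of_mem hd; omega
    · have := inv_mul_s_of_notMem hd
      rw [sortWord, List.foldl_append]
      change sortStep i (sortWord w 1) = _
      rw [ih (by omega), sortStep_of_notMem hd]

theorem IsReducedWord.sortWord_one {w : List (Fin (n - 1))} {τ : Perm (Fin n)}
    (h : IsReducedWord w τ) : sortWord w 1 = τ := by
  rw [sortWord_one_of_length_eq w (by rw [h.length_eq, h.1]), h.1]

/-- Sorting positions along a reduced word of `τ`, starting from `x`, amounts to sorting values
along a reduced word of `x⁻¹`, starting from `τ`. -/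
theorem sortWord_eq_sortLeftWord {w u : List (Fin (n - 1))} {τ x : Perm (Fin n)}
    (hw : IsReducedWord w τ) (hu : IsReducedWord u x⁻¹) : sortWord w x = sortLeftWord u τ := by
  have hx : sortLeftWord u 1 = x := by
    rw [sortLeftWord_eq, _root_.inv_one, hu.sortWord_one, inv_inv]
  rw [← hw.sortWord_one, sortLeftWord_sortWord, hx]

theorem inv_sortLeft (j : Fin (n - 1)) (μ : Perm (Fin n)) :
    (j ∈ Des μ⁻¹ ∧ sortLeft j μ = μ) ∨ inv (sortLeft j μ) = inv μ + 1 := by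
  by_cases h : j ∈ Des μ⁻¹
  · exact Or.inl ⟨h, sortLeft_of_mem h⟩
  · right
    rw [sortLeft, sortStep_of_notMem h, inv_inverse, inv_mul_s_of_notMem h, inv_inverse]

theorem inv_le_inv_sortLeftWord (u : List (Fin (n - 1))) (μ : Perm (Fin n)) :
    inv μ ≤ inv (sortLeftWord u μ) := by
  induction u generalizing μ with
  | nil => exact le_rfl
  | cons j u ih =>
    refine le_trans ?_ (ih (sortLeft j μ))
    rcases inv_sortLeft j μ with h | h
    · rw [h.2]
    · omega

/-- Each value sort fixes its argument or adds one inversion, so a total gain of zero means that no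
step moved anything. -/
theorem sortLeftWord_of_inv_le {u : List (Fin (n - 1))} {μ : Perm (Fin n)}
    (h : inv (sortLeftWord u μ) ≤ inv μ) : sortLeftWord u μ = μ ∧ ∀ j ∈ u, j ∈ Des μ⁻¹ := by
  induction u generalizing μ with
  | nil => exact ⟨rfl, by simp⟩
  | cons j u ih =>
    change inv (sortLeftWord u (sortLeft j μ)) ≤ inv μ at h
    change sortLeftWord u (sortLeft j μ) = μ ∧ _
    rcases inv_sortLeft j μ with hj | hj
    · rw [hj.2] at h ⊢
      obtain ⟨h1, h2⟩ := ih h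
      exact ⟨h1, by simpa using ⟨hj.1, h2⟩⟩
    · have := inv_le_inv_sortLeftWord u (sortLeft j μ)
      omega

/-! ### Blocks of a set of adjacent transpositions -/

/-- The number of the block containing `a`, where `a` and `a + 1` belong to the same block
exactly when the corresponding index lies in `J`. -/
def blk (J : Finset (Fin (n - 1))) (a : Fin n) : ℕ :=
  (Finset.univ.filter fun i : Fin (n - 1) => i ∉ J ∧ i.1 < a.1).card

theorem blk_s {J : Finset (Fin (n - 1))} {i : Fin (n - 1)} (hi' : i ∈ J) (a : Fin n) :
    blk J (s i a) = blk J a := by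
  have key : blk J (lo i) = blk J (hi i) := by
    refine congrArg Finset.card (Finset.filter_congr fun k _ => and_congr_right fun hk => ?_)
    simp only [lo, hi]
    have : k.1 ≠ i.1 := fun e => hk (by rwa [Fin.ext e])
    omega
  by_cases h1 : a = lo i
  · rw [h1, s_lo, key]
  by_cases h2 : a = hi i
  · rw [h2, s_hi, key]
  rw [s, swap_apply_of_ne_of_ne h1 h2]

theorem blk_wordProd {J : Finset (Fin (n - 1))} {u : List (Fin (n - 1))} (hu : ∀ j ∈ u, j ∈ J)
    (a : Fin n) : blk J (wordProd u a) = blk J a := by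
  induction u with
  | nil => rfl
  | cons j u ih =>
    have : wordProd (j :: u) = s j * wordProd u := by simp [wordProd]
    rw [this, Perm.mul_apply, blk_s (hu j (by simp)), ih fun k hk => hu k (by simp [hk])]

theorem mem_of_blk_eq {J : Finset (Fin (n - 1))} {a b : Fin n} (h : blk J a = blk J b)
    {i : Fin (n - 1)} (hai : a.1 ≤ i.1) (hib : i.1 < b.1) : i ∈ J := by
  by_contra hi'
  refine h.not_lt (Finset.card_lt_card ?_)
  rw [Finset.ssubset_iff_of_subset]
  · exact ⟨i, by simp [hi', hib], by simp; omega⟩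
  · intro k hk
    simp only [Finset.mem_filter, Finset.mem_univ, true_and] at hk ⊢
    exact ⟨hk.1, by omega⟩

theorem lt_of_blk_eq {α : Type*} [Preorder α] {J : Finset (Fin (n - 1))} {f : Fin n → α}
    (hf : ∀ i ∈ J, f (lo i) < f (hi i)) {a b : Fin n} (hab : a < b) (h : blk J a = blk J b) :
    f a < f b := by
  have key : ∀ k (hk : k < n), a.1 + 1 ≤ k → k ≤ b.1 → f a < f ⟨k, hk⟩ := by
    intro k hk hak
    induction k, hak using Nat.le_induction with
    | base =>
      intro hb
      exact hf ⟨a.1, by omega⟩ (mem_of_blk_eq h le_rfl hab)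
    | succ k hak ih =>
      intro hb
      exact (ih (by omega) (by omega)).trans
        (hf ⟨k, by omega⟩ (mem_of_blk_eq h (by simp; omega) (by simp; omega)))
  exact key b.1 b.2 hab le_rfl

/-- The least moved point cannot be sent lower, since all smaller values are already taken by fixed
points. -/
theorem exists_first_moved {u : Perm (Fin n)} (hu : u ≠ 1) :
    ∃ a, (∀ b < a, u b = b) ∧ a < u a := by
  have hne : (Finset.univ.filter fun a => u a ≠ a).Nonempty := by
    by_contra h
    rw [Finset.not_nonempty_iff_eq_empty, Finset.filter_eq_empty_iff] at h
    exact hu (Perm.ext fun a => by simpa using h (Finset.mem_univ a))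
  obtain ⟨a, ha⟩ := Finset.exists_minimal hne
  have ha1 : u a ≠ a := by simpa using ha.1
  have hfix : ∀ b < a, u b = b := fun b hb => by
    by_contra h
    exact ha.not_lt (by simpa using h) hb
  refine ⟨a, hfix, lt_of_le_of_ne (not_lt.1 fun h => ha1 (u.injective (hfix _ h))) ha1.symm⟩

/-- A coset of a Young subgroup contains at most one permutation increasing on the blocks. -/
theorem eq_one_of_increasing_on_blocks {J : Finset (Fin (n - 1))} {σ u : Perm (Fin n)}
    (hu : ∀ a, blk J (u a) = blk J a) (h1 : ∀ i ∈ J, i ∉ Des σ) (h2 : ∀ i ∈ J, i ∉ Des (σ * u)) :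
    u = 1 := by
  by_contra hne
  obtain ⟨a, hfix, ha⟩ := exists_first_moved hne
  have hb : a < u⁻¹ a := by
    rcases lt_trichotomy (u⁻¹ a) a with h | h | h
    · exact absurd ((apply_inv_apply u a).symm.trans (hfix _ h)) h.ne'
    · rw [Perm.inv_eq_iff_eq] at h
      exact absurd ha (h ▸ lt_irrefl _)
    · exact h
  -- Monotonicity of `σ` gives `σ a < σ (u a)`; that of `σ * u`, applied to `a < u⁻¹ a`, gives the
  -- reverse inequality.
  have e1 : σ a < σ (u a) := lt_of_blk_eq (fun i hi' => not_mem_Des.1 (h1 i hi')) ha (hu a).symm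
  have e2 : (σ * u) a < (σ * u) (u⁻¹ a) := by
    refine lt_of_blk_eq (fun i hi' => not_mem_Des.1 (h2 i hi')) hb ?_
    rw [← hu (u⁻¹ a), apply_inv_apply]
  rw [Perm.mul_apply, Perm.mul_apply, apply_inv_apply] at e2
  exact lt_asymm e1 e2

/-! ### The operators on basis vectors -/

@[simp] theorem sigmaOp_single (σ μ : Perm (Fin n)) (c : ℂ) :
    sigmaOp σ (Finsupp.single μ c) = Finsupp.single (μ * σ) c := by
  simp [sigmaOp, Finsupp.lmapDomain_apply, Finsupp.mapDomain_single]

@[simp] theorem piOp_single (i : Fin (n - 1)) (μ : Perm (Fin n)) (c : ℂ) :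
    piOp i (Finsupp.single μ c) = Finsupp.single (sortStep i μ) c := by
  simp [piOp, Finsupp.lmapDomain_apply, Finsupp.mapDomain_single]

theorem piWord_single (w : List (Fin (n - 1))) (μ : Perm (Fin n)) (c : ℂ) :
    piWord w (Finsupp.single μ c) = Finsupp.single (sortWord w μ) c := by
  induction w generalizing μ with
  | nil => rfl
  | cons i w ih =>
    change piWord w (piOp i (Finsupp.single μ c)) = _
    rw [piOp_single, ih]; rfl

theorem piPerm_single {u : List (Fin (n - 1))} {x : Perm (Fin n)} (hu : IsReducedWord u x⁻¹)
    (τ : Perm (Fin n)) (c : ℂ) :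
    piPerm τ (Finsupp.single x c) = Finsupp.single (sortLeftWord u τ) c := by
  rw [piPerm, piWord_single, sortWord_eq_sortLeftWord (exists_reducedWord τ).choose_spec hu]

/-- The value at `x` depends only on `τ` and a reduced word of `x⁻¹`, which gives independence of
the chosen word without braid relations. -/
theorem piWord_eq_piPerm {w : List (Fin (n - 1))} {τ : Perm (Fin n)} (hw : IsReducedWord w τ) :
    piWord w = piPerm τ := by
  refine Finsupp.lhom_ext fun x c => ?_
  obtain ⟨u, hu⟩ := exists_reducedWord x⁻¹
  rw [piPerm_single hu, piWord_single, sortWord_eq_sortLeftWord hw hu]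

/-! ### Linear independence -/

/-- Triangularity: reaching `τ₀` from `τ` without gaining inversions forces `τ = τ₀`; then `σ` and
`σ₀` lie in one coset of the Young subgroup of `Des τ⁻¹`, and both increase on its blocks. -/
theorem B_apply_eq_zero {p q : BIndex n} (hinv : inv q.1.2 ≤ inv p.1.2) (hpq : p ≠ q) :
    B n p (Finsupp.single q.1.1⁻¹ 1) q.1.2 = 0 := by
  obtain ⟨⟨σ, τ⟩, hp⟩ := p
  obtain ⟨⟨σ₀, τ₀⟩, hq⟩ := q
  change inv τ₀ ≤ inv τ at hinv
  change piPerm τ (sigmaOp σ (Finsupp.single σ₀⁻¹ 1)) τ₀ = 0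
  obtain ⟨u, hu⟩ := exists_reducedWord (σ₀⁻¹ * σ)⁻¹
  rw [sigmaOp_single, piPerm_single hu, Finsupp.single_apply, if_neg]
  intro he
  obtain ⟨h1, h2⟩ := sortLeftWord_of_inv_le (u := u) (μ := τ) (he ▸ hinv)
  have hτ : τ = τ₀ := h1.symm.trans he
  subst hτ
  have hx : (σ₀⁻¹ * σ)⁻¹ = 1 := by
    refine eq_one_of_increasing_on_blocks (J := Des τ⁻¹) (σ := σ) ?_ ?_ ?_
    · rw [← hu.1]; exact blk_wordProd h2
    · intro i hi' hi''
      exact Finset.notMem_empty i (hp ▸ Finset.mem_inter.2 ⟨hi'', hi'⟩)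
    · intro i hi' hi''
      rw [mul_inv_rev, inv_inv, mul_inv_cancel_left] at hi''
      exact Finset.notMem_empty i (hq ▸ Finset.mem_inter.2 ⟨hi'', hi'⟩)
  rw [inv_eq_one, inv_mul_eq_one] at hx
  subst hx
  exact hpq rfl

theorem B_apply_self (q : BIndex n) : B n q (Finsupp.single q.1.1⁻¹ 1) q.1.2 = 1 := by
  change piPerm q.1.2 (sigmaOp q.1.1 (Finsupp.single q.1.1⁻¹ 1)) q.1.2 = 1
  have hu : IsReducedWord [] ((1 : Perm (Fin n))⁻¹) := ⟨by simp [wordProd], by simp⟩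
  rw [sigmaOp_single, inv_mul_cancel, piPerm_single hu]
  exact Finsupp.single_eq_same

theorem linearIndependent_B (n : ℕ) : LinearIndependent ℂ (B n) := by
  refine (Fintype.linearIndependent_iff (R := ℂ) (M := Module.End ℂ (V n)) (v := B n)).2 ?_
  intro c hc
  by_contra! hne
  -- Choosing `q` with fewest inversions in `τ` makes every other term of the relation vanish at the
  -- coefficient tested below.
  obtain ⟨q, hq, hmin⟩ := Finset.exists_min_image (Finset.univ.filter fun p => c p ≠ 0)
    (fun p => inv p.1.2) (by simpa [Finset.Nonempty] using hne)
  have h := congrArg (fun f => f (Finsupp.single q.1.1⁻¹ 1) q.1.2) hc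
  simp only [LinearMap.sum_apply, Finsupp.finsetSum_apply, LinearMap.smul_apply,
    Finsupp.smul_apply, LinearMap.zero_apply, Finsupp.zero_apply] at h
  rw [Finset.sum_eq_single q, B_apply_self, smul_eq_mul, mul_one] at h
  · exact (Finset.mem_filter.1 hq).2 h
  · intro p _ hpq
    by_cases hp : c p = 0
    · rw [hp, zero_smul]
    · rw [B_apply_eq_zero (hmin p (by simpa using hp)) hpq, smul_zero]
  · simp

/-! ### Operators preserving left antisymmetries -/

/-- The operator of left multiplication by a permutation (action on values). -/
noncomputable def leftOp (σ : Perm (Fin n)) : Module.End ℂ (V n) :=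
  Finsupp.lmapDomain ℂ ℂ fun μ => σ * μ

@[simp] theorem leftOp_single (σ μ : Perm (Fin n)) (c : ℂ) :
    leftOp σ (Finsupp.single μ c) = Finsupp.single (σ * μ) c := by
  simp [leftOp, Finsupp.lmapDomain_apply, Finsupp.mapDomain_single]

theorem leftOp_s_apply (j : Fin (n - 1)) (v : V n) (μ : Perm (Fin n)) :
    leftOp (s j) v μ = v (s j * μ) := by
  have := Finsupp.mapDomain_apply (f := fun μ => s j * μ) (mul_right_injective (s j)) v (s j * μ)
  simpa [leftOp, Finsupp.lmapDomain_apply] using this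

/-- The algebra of the operators which preserve, for all `j`, the space of the vectors
antisymmetric under the exchange of the values `j` and `j + 1`. -/
noncomputable def antisymmPreserving (n : ℕ) : Subalgebra ℂ (Module.End ℂ (V n)) where
  carrier := {f | ∀ j v, leftOp (s j) v = -v → leftOp (s j) (f v) = -f v}
  mul_mem' hf hg j v hv := hf j _ (hg j v hv)
  add_mem' hf hg j v hv := by
    simp only [LinearMap.add_apply, map_add, hf j v hv, hg j v hv, neg_add]
  algebraMap_mem' c j v hv := by
    simp only [Module.algebraMap_end_apply, map_smul, hv, smul_neg]

/-- An antisymmetric `v` is half of `v - leftOp (s j) v`, so it suffices to treat the differences `μ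
- s j * μ`: `f` kills such a difference in the first case and commutes with the exchange on it in
the second. -/
theorem mem_antisymmPreserving_of_single {f : Module.End ℂ (V n)}
    (h : ∀ (j : Fin (n - 1)) (μ : Perm (Fin n)),
      f (Finsupp.single (s j * μ) 1) = f (Finsupp.single μ 1) ∨
      f (Finsupp.single (s j * μ) 1) = leftOp (s j) (f (Finsupp.single μ 1))) :
    f ∈ antisymmPreserving n := by
  intro j v hv
  have hinvol : ∀ x : V n, leftOp (s j) (leftOp (s j) x) = x := fun x => by
    ext μ; rw [leftOp_s_apply, leftOp_s_apply, s_mul_s_mul]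
  have key : leftOp (s j) ∘ₗ f ∘ₗ (LinearMap.id - leftOp (s j)) =
      -(f ∘ₗ (LinearMap.id - leftOp (s j))) := by
    refine Finsupp.lhom_ext' fun μ => LinearMap.ext_ring ?_
    simp only [LinearMap.comp_apply, Finsupp.lsingle_apply, LinearMap.sub_apply,
      LinearMap.id_apply, leftOp_single, map_sub, LinearMap.neg_apply]
    rcases h j μ with h | h
    · rw [h]; simp
    · rw [h, hinvol]; abel
  have := LinearMap.congr_fun key v
  simp only [LinearMap.comp_apply, LinearMap.sub_apply, LinearMap.id_apply, hv,
    LinearMap.neg_apply, sub_neg_eq_add, map_add] at this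
  rw [← two_smul ℂ, ← two_smul ℂ (f v), ← smul_neg] at this
  exact smul_right_injective _ (two_ne_zero' ℂ) this

theorem HS_le_antisymmPreserving (n : ℕ) : HS n ≤ antisymmPreserving n := by
  refine Algebra.adjoin_le ?_
  rintro _ (⟨i, rfl⟩ | ⟨i, rfl⟩)
  · refine mem_antisymmPreserving_of_single fun j μ => Or.inr ?_
    rw [sigmaOp_single, sigmaOp_single, leftOp_single, mul_assoc]
  · refine mem_antisymmPreserving_of_single fun j μ => ?_
    rw [piOp_single, piOp_single, leftOp_single]
    exact (sortStep_s_mul i j μ).imp (fun h => by rw [h]) (fun h => by rw [h])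

/-- A vector antisymmetric for all elements of `J` is determined by its coefficients at the
permutations whose inverse has all elements of `J` as descents. -/
theorem eq_zero_of_antisymm {J : Finset (Fin (n - 1))} {v : V n}
    (hv : ∀ j ∈ J, leftOp (s j) v = -v) (h : ∀ ν : Perm (Fin n), J ⊆ Des ν⁻¹ → v ν = 0) :
    v = 0 := by
  have hbound : ∀ ν : Perm (Fin n), inv ν ≤ Fintype.card (Fin n × Fin n) :=
    fun ν => Finset.card_le_univ _
  -- Downward induction on inversions: if `j ∈ J` is not a descent of `ν⁻¹`, then `v ν = -v (s j *
  -- ν)`, and `s j * ν` has one more inversion.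
  have key : ∀ k, ∀ ν : Perm (Fin n), Fintype.card (Fin n × Fin n) - inv ν = k → v ν = 0 := by
    intro k
    induction k using Nat.strong_induction_on with
    | _ k ih =>
      intro ν hk
      by_cases hJ : J ⊆ Des ν⁻¹
      · exact h ν hJ
      obtain ⟨j, hj, hd⟩ := Finset.not_subset.1 hJ
      have hlen : inv (s j * ν) = inv ν + 1 := by
        rw [← inv_inverse, mul_inv_rev, s_inv, inv_mul_s_of_notMem hd, inv_inverse]
      have h1 := ih _ (by have := hbound (s j * ν); omega) (s j * ν) rfl
      have h2 := DFunLike.congr_fun (hv j hj) ν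
      rw [leftOp_s_apply, h1, Finsupp.neg_apply] at h2
      exact neg_eq_zero.1 h2.symm
  ext ν
  exact key _ ν rfl

/-- The antisymmetrization of `μ` under the Young subgroup of the blocks of `J`. -/
noncomputable def antisymmetrize (J : Finset (Fin (n - 1))) (μ : Perm (Fin n)) : V n :=
  ∑ u ∈ Finset.univ.filter (fun u : Perm (Fin n) => ∀ a, blk J (u a) = blk J a),
    Finsupp.single (u * μ) ((Perm.sign u : ℤ) : ℂ)

theorem leftOp_antisymmetrize {J : Finset (Fin (n - 1))} {j : Fin (n - 1)} (hj : j ∈ J)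
    (μ : Perm (Fin n)) : leftOp (s j) (antisymmetrize J μ) = -antisymmetrize J μ := by
  rw [antisymmetrize, map_sum, ← Finset.sum_neg_distrib]
  refine Finset.sum_equiv (Equiv.mulLeft (s j)) (fun u => ?_) (fun u _ => ?_)
  · simp [blk_s hj]
  · have : Perm.sign (s j) = -1 := Perm.sign_swap (lo_lt_hi j).ne
    simp [this, mul_assoc]

/-- The first point moved by `u⁻¹` goes to a larger one in its block, and `μ⁻¹` decreases on the
blocks of its own descent set. -/
theorem toLex_lt_of_blk {μ u : Perm (Fin n)} (hu : ∀ a, blk (Des μ⁻¹) (u a) = blk (Des μ⁻¹) a)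
    (hne : u ≠ 1) : toLex ⇑(u * μ)⁻¹ < toLex ⇑μ⁻¹ := by
  obtain ⟨a, hfix, ha⟩ := exists_first_moved (inv_ne_one.2 hne)
  refine ⟨a, fun b hb => ?_, ?_⟩
  · change (u * μ)⁻¹ b = μ⁻¹ b
    rw [mul_inv_rev, Perm.mul_apply, hfix b hb]
  · change (u * μ)⁻¹ a < μ⁻¹ a
    rw [mul_inv_rev, Perm.mul_apply]
    refine lt_of_blk_eq (α := (Fin n)ᵒᵈ) (J := Des μ⁻¹) (f := fun x => OrderDual.toDual (μ⁻¹ x))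
      (fun i hi' => mem_Des.1 hi') ha ?_
    rw [← hu (u⁻¹ a), apply_inv_apply]

theorem eq_zero_of_mem_antisymmPreserving {f : Module.End ℂ (V n)}
    (hf : f ∈ antisymmPreserving n)
    (h : ∀ μ ν : Perm (Fin n), Des μ⁻¹ ⊆ Des ν⁻¹ → f (Finsupp.single μ 1) ν = 0) : f = 0 := by
  have key : ∀ μ : Perm (Fin n), f (Finsupp.single μ 1) = 0 := by
    intro μ
    induction μ using (InvImage.wf (fun μ : Perm (Fin n) => toLex ⇑μ⁻¹)
      (wellFounded_lt (α := Lex (Fin n → Fin n)))).induction with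
    | _ μ ih =>
      -- All terms except `u = 1` are lexicographically smaller and are killed by induction, so `f`
      -- sends `μ` to an antisymmetric vector.
      have hsum : f (antisymmetrize (Des μ⁻¹) μ) = f (Finsupp.single μ 1) := by
        rw [antisymmetrize, map_sum, Finset.sum_eq_single 1]
        · simp
        · intro u hu hne
          rw [← Finsupp.smul_single_one, map_smul,
            ih (u * μ) (toLex_lt_of_blk (Finset.mem_filter.1 hu).2 hne), smul_zero]
        · simp
      refine eq_zero_of_antisymm (J := Des μ⁻¹) (fun j hj => ?_) (fun ν hν => h μ ν hν)
      rw [← hsum]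
      exact hf j _ (leftOp_antisymmetrize hj μ)
  refine Finsupp.lhom_ext' fun μ => LinearMap.ext_ring ?_
  simpa using key μ

theorem card_BIndex (n : ℕ) : Fintype.card (BIndex n) = h n := by
  rw [h, ← Fintype.card_subtype]
  exact Fintype.card_congr
    (Equiv.subtypeEquiv ((Equiv.refl _).prodCongr (Equiv.inv _)) fun p => by simp)

theorem Des_rev_mul (μ : Perm (Fin n)) : Des (Fin.revPerm * μ) = (Des μ)ᶜ := by
  ext i
  rw [Finset.mem_compl, not_mem_Des, mem_Des]
  simp

/-- Reversing the values of `p.2⁻¹` complements its descent set, turning containment into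
disjointness. -/
theorem card_Des_subset (n : ℕ) :
    Fintype.card {p : Perm (Fin n) × Perm (Fin n) // Des p.1⁻¹ ⊆ Des p.2⁻¹} = h n := by
  rw [h, ← Fintype.card_subtype]
  refine Fintype.card_congr (Equiv.subtypeEquiv ((Equiv.inv _).prodCongr
    ((Equiv.inv _).trans (Equiv.mulLeft Fin.revPerm))) fun p => ?_)
  simp [Des_rev_mul, ← Finset.disjoint_iff_inter_eq_empty, disjoint_compl_right_iff]

theorem finrank_antisymmPreserving_le (n : ℕ) :
    Module.finrank ℂ (Subalgebra.toSubmodule (antisymmPreserving n)) ≤ h n := by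
  let coeffs : Subalgebra.toSubmodule (antisymmPreserving n) →ₗ[ℂ]
      ({p : Perm (Fin n) × Perm (Fin n) // Des p.1⁻¹ ⊆ Des p.2⁻¹} → ℂ) :=
    { toFun := fun f p => (f : Module.End ℂ (V n)) (Finsupp.single p.1.1 1) p.1.2
      map_add' := fun f g => by ext p; simp
      map_smul' := fun c f => by ext p; simp }
  have hinj : Function.Injective coeffs := by
    intro f g hfg
    have hmem : (f - g : Module.End ℂ (V n)) ∈ antisymmPreserving n := fun j v hv => by
      rw [LinearMap.sub_apply, map_sub, f.2 j v hv, g.2 j v hv]; abel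
    have hzero := eq_zero_of_mem_antisymmPreserving hmem fun μ ν hμν => by
      rw [LinearMap.sub_apply, Finsupp.sub_apply, sub_eq_zero]
      exact congrFun hfg ⟨(μ, ν), hμν⟩
    exact Subtype.ext (sub_eq_zero.1 hzero)
  have := LinearMap.finrank_le_finrank_of_injective hinj
  rwa [Module.finrank_fintype_fun_eq_card, card_Des_subset] at this

/-! ### The basis -/

theorem rmul_mem_HS {f g : Module.End ℂ (V n)} (hf : f ∈ HS n) (hg : g ∈ HS n) :
    rmul f g ∈ HS n := (HS n).mul_mem hg hf

theorem sigmaOp_mem_HS (σ : Perm (Fin n)) : sigmaOp σ ∈ HS n := by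
  obtain ⟨w, rfl⟩ := exists_word σ
  induction w with
  | nil =>
    have : sigmaOp (wordProd ([] : List (Fin (n - 1)))) = 1 :=
      Finsupp.lhom_ext fun μ c => by simp [wordProd]
    rw [this]
    exact (HS n).one_mem
  | cons i w ih =>
    have : sigmaOp (wordProd (i :: w)) = rmul (sigmaOp (s i)) (sigmaOp (wordProd w)) :=
      Finsupp.lhom_ext fun μ c => by simp [wordProd, rmul, mul_assoc]
    rw [this]
    exact rmul_mem_HS (Algebra.subset_adjoin (Or.inl ⟨i, rfl⟩)) ih

theorem piWord_mem_HS (w : List (Fin (n - 1))) : piWord w ∈ HS n := by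
  induction w with
  | nil => exact (HS n).one_mem
  | cons i w ih => exact rmul_mem_HS (Algebra.subset_adjoin (Or.inr ⟨i, rfl⟩)) ih

theorem span_B_le_HS (n : ℕ) :
    Submodule.span ℂ (Set.range (B n)) ≤ Subalgebra.toSubmodule (HS n) := by
  rw [Submodule.span_le]
  rintro _ ⟨p, rfl⟩
  exact rmul_mem_HS (sigmaOp_mem_HS _) (piWord_mem_HS _)

theorem finrank_span_B (n : ℕ) : Module.finrank ℂ (Submodule.span ℂ (Set.range (B n))) = h n := by
  rw [finrank_span_eq_card (linearIndependent_B n), card_BIndex]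

theorem span_B_eq_HS (n : ℕ) :
    Submodule.span ℂ (Set.range (B n)) = Subalgebra.toSubmodule (HS n) := by
  refine Submodule.eq_of_le_of_finrank_le (K := ℂ) (V := Module.End ℂ (V n)) (span_B_le_HS n) ?_
  rw [finrank_span_B]
  exact (Submodule.finrank_mono (Subalgebra.toSubmodule.monotone (HS_le_antisymmPreserving n))).trans
    (finrank_antisymmPreserving_le n)

end HeckeSymm

theorem theorem3p1 (n : ℕ) :
    (∀ (τ : Equiv.Perm (Fin n)) (w : List (Fin (n - 1))),
      HeckeSymm.IsReducedWord w τ → HeckeSymm.piWord w = HeckeSymm.piPerm τ) ∧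
    LinearIndependent ℂ (HeckeSymm.B n) ∧
    Submodule.span ℂ (Set.range (HeckeSymm.B n)) = Subalgebra.toSubmodule (HeckeSymm.HS n) ∧
    Module.finrank ℂ (HeckeSymm.HS n) = HeckeSymm.h n := by
  refine ⟨fun τ w hw => HeckeSymm.piWord_eq_piPerm hw, HeckeSymm.linearIndependent_B n,
    HeckeSymm.span_B_eq_HS n, ?_⟩
  rw [← Subalgebra.finrank_toSubmodule, ← HeckeSymm.span_B_eq_HS, HeckeSymm.finrank_span_B]
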